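/- All systems are real, finite-dimensional, discrete-time, causal LTI systems given by state-space matrices $(A,B,C,D)$ and acting on two-sided signals with state tending to $0$ at $t=-\infty$. A system is stable if the spectral radius of its state matrix is less than $1$; for a stable system $G$ with transfer function $G(z)=C(zI-A)^{-1}B+D$, $\|G\|_\infty=\max_{\theta\in[0,2\pi]}\bar\sigma(G(e^{j\theta}))$. For $d:\mathbb Z\to\mathbb R^{n}$, $\|d\|_2^2=\sum_{t\in\mathbb Z}d_t^\top d_t$, and $d\in\ell_2$ if this is finite. **Plant and closed loop.** Let $P$ be the plant $$x_{t+1}=Ax_t+B_ww_t+B_dd_t+B_uu_t,\quad v_t=C_vx_t+D_{vw}w_t+D_{vd}d_t+D_{vu}u_t,$$ $$e_t=C_ex_t+D_{eu}u_t,\quad y_t=C_yx_t+D_{yw}w_t+D_{yd}d_t .$$ Let $K$ be a controller (a causal LTI system of any order), $u=Ky$. Let $\mathbf\Delta$ be the set of stable $n_w\times n_v$ systems $\Delta$, of any order, with $\|\Delta\|_\infty\le 1$. $CL(P,K,\Delta)$ is the system from $d$ to $e$ obtained by closing the loops $u=Ky$ and $w=\Delta v$; its state consists of the states of $P$, $K$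 and $\Delta$. It is well-posed if the algebraic loop is nonsingular, i.e. $\begin{bmatrix} I&-\bar D_{vw}\\-D_\Delta&I\end{bmatrix}$ is nonsingular, where $\bar D_{vw}=D_{vw}+D_{vu}D_KD_{yw}$ is the feedthrough from $w$ to $v$ after closing $K$. When it is well-posed and stable, write $J(K,d,\Delta)=\|CL(P,K,\Delta)d\|_2^2$. **Benchmark.** Put $Q=C_e^\top C_e$, $S=C_e^\top D_{eu}$, $R=D_{eu}^\top D_{eu}$. Assume: $R\succ0$; $(A,B_u)$ is stabilizable; $A-B_uR^{-1}S^\top$ is nonsingular; and $\begin{bmatrix}A-e^{j\theta}I&B_u\\C_e&D_{eu}\end{bmatrix}$ has full column rank for all $\theta\in[0,2\pi]$. Let $X\succeq0$ be the stabilizing solution of $$0=X-A^\top XA-Q+(A^\top XB_u+S)H^{-1}(A^\top XB_u+S)^\top,\qquad H=R+B_u^\top XB_u,$$ i.e. $A-B_uK_x$ has spectral radius less than $1$, where $K_x=H^{-1}(A^\top XB_u+S)^\top$. The optimal non-causal controller $K^o$ of the nominal model ($\Delta=0$) is $$v_t=(A-B_uK_x)^\top(v_{t+1}+XB_dd_t),\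 v_\infty=0,\qquad u_t=-K_xx_t-H^{-1}B_u^\top v_{t+1}-H^{-1}B_u^\top XB_d\,d_t ,$$ (here $v$ denotes the internal state of $K^o$). Let $e^o$ be the error it produces on the nominal plant $x_{t+1}=Ax_t+B_dd_t+B_uu_t$, $e^o_t=C_ex_t+D_{eu}u_t$, $x_{-\infty}=0$, and let $J(K^o,d,0)=\|e^o\|_2^2$. **Spectral factor.** Let $\gamma_d,\gamma_J\ge0$ and $\hat e_t=\begin{bmatrix}\gamma_Je^o_t\\\gamma_dd_t\end{bmatrix}$. Let $F$ be any spectral factor of the benchmark cost: a stable $n_d\times n_d$ system with $D_F$ invertible and $F^{-1}$ stable such that $\|Fd\|_2^2=\|\hat e\|_2^2$ for all $d\in\ell_2$. **Robust regret.** $K$ achieves robust $(\gamma_d,\gamma_J)$-regret relative to $K^o$ if, for every $\Delta\in\mathbf\Delta$, $CL(P,K,\Delta)$ is well-posed and stable and the inequality $J(K,d,\Delta)<\gamma_d^2\|d\|_2^2+\gamma_J^2J(K^o,d,0)$ holds uniformly in $d$, i.e. there is $\varepsilon>0$ with $$J(K,d,\Delta)\le\gamma_d^2\|d\|_2^2+\gamma_J^2J(K^o,d,0)-\varepsilon\|d\|_2^2\qquad\text{for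 all } d\in\ell_2 .$$ It achieves *pointwise* robust $(\gamma_d,\gamma_J)$-regret if instead, for every $\Delta\in\mathbf\Delta$, $CL(P,K,\Delta)$ is well-posed and stable and $J(K,d,\Delta)<\gamma_d^2\|d\|_2^2+\gamma_J^2J(K^o,d,0)$ for each nonzero $d\in\ell_2$. **Theorem.** 1. $K$ achieves robust $(\gamma_d,\gamma_J)$-regret relative to $K^o$ if and only if, for all $\Delta\in\mathbf\Delta$, $CL(P,K,\Delta)F^{-1}$ is well-posed, stable, and $\|CL(P,K,\Delta)F^{-1}\|_\infty<1$. (Here $CL(P,K,\Delta)F^{-1}$ is the series connection, well-posed when $CL(P,K,\Delta)$ is.) 2. Robust regret implies pointwise robust regret. 3. Pointwise robust regret implies that, for all $\Delta\in\mathbf\Delta$, $CL(P,K,\Delta)F^{-1}$ is well-posed, stable, and $\|CL(P,K,\Delta)F^{-1}\|_\infty\le1$. -/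

import Mathlib

open Matrix Filter Topology

namespace RobustRegret

noncomputable section

/-! ### Two-sided square-summable signals -/

/-- The signal `s` belongs to `ℓ₂`: the sum of `s_tᵀ s_t` over all integers `t` is finite. -/
def MemL2 {ι : Type} [Fintype ι] (s : ℤ → ι → ℝ) : Prop :=
  Summable fun t => s t ⬝ᵥ s t

/-- The squared `ℓ₂` norm, the sum of `s_tᵀ s_t` over all integers `t`. -/
def sqNorm {ι : Type} [Fintype ι] (s : ℤ → ι → ℝ) : ℝ :=
  ∑' t, s t ⬝ᵥ s t

/-- A real square matrix is Schur if its (complex) spectral radius is less than one. -/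
def IsSchur {σ : Type} [Fintype σ] [DecidableEq σ] (A : Matrix σ σ ℝ) : Prop :=
  spectralRadius ℂ (A.map (algebraMap ℝ ℂ)) < 1

/-! ### Causal finite-dimensional LTI systems -/

/-- A causal discrete-time LTI system `x_{t+1} = A x_t + B d_t`, `e_t = C x_t + D d_t` with state,
input and output coordinates indexed by `σ`, `ι` and `ο`. -/
structure StateSpace (σ ι ο : Type) where
  A : Matrix σ σ ℝ
  B : Matrix σ ι ℝ
  C : Matrix ο σ ℝ
  D : Matrix ο ι ℝ

namespace StateSpace

variable {σ τ ι κ ο π : Type}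

/-- The signals `(d, x, e)` satisfy the dynamics of `G` with `x_{-∞} = 0`. When `G` is stable, every
`d` in `ℓ₂` has exactly one such `(x, e)`, and it lies in `ℓ₂`. -/
def IsTrajectory [Fintype σ] [Fintype ι] (G : StateSpace σ ι ο)
    (d : ℤ → ι → ℝ) (x : ℤ → σ → ℝ) (e : ℤ → ο → ℝ) : Prop :=
  (∀ t, x (t + 1) = G.A *ᵥ x t + G.B *ᵥ d t) ∧
  (∀ t, e t = G.C *ᵥ x t + G.D *ᵥ d t) ∧
  Tendsto x atBot (𝓝 0)

/-- (Internal) stability: the state matrix is Schur. -/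
def IsStable [Fintype σ] [DecidableEq σ] (G : StateSpace σ ι ο) : Prop :=
  IsSchur G.A

/-- The transfer function `G(z) = C (z I - A)⁻¹ B + D`. -/
def transfer [Fintype σ] [DecidableEq σ] (G : StateSpace σ ι ο) (z : ℂ) : Matrix ο ι ℂ :=
  G.C.map (algebraMap ℝ ℂ) * (z • (1 : Matrix σ σ ℂ) - G.A.map (algebraMap ℝ ℂ))⁻¹ *
    G.B.map (algebraMap ℝ ℂ) + G.D.map (algebraMap ℝ ℂ)

open scoped Matrix.Norms.L2Operator in
/-- The `H∞` norm of a stable system: the maximum over `θ ∈ [0, 2π]` of the largest singular value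
(the `ℓ²` operator norm) of `G(e^{jθ})`. -/
def hInfNorm [Fintype σ] [DecidableEq σ] [Fintype ι] [DecidableEq ι] [Fintype ο] [DecidableEq ο]
    (G : StateSpace σ ι ο) : ℝ :=
  ⨆ θ : Set.Icc (0 : ℝ) (2 * Real.pi), ‖G.transfer (Complex.exp ((θ : ℝ) * Complex.I))‖

/-- The series connection `G H` (first `H`, then `G`), with state `(x_G, x_H)`. -/
def series [Fintype ο] (G : StateSpace σ ο π) (H : StateSpace τ ι ο) :
    StateSpace (σ ⊕ τ) ι π where
  A := fromBlocks G.A (G.B * H.C) 0 H.A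
  B := fromRows (G.B * H.D) H.B
  C := fromCols G.C (G.D * H.C)
  D := G.D * H.D

/-- The inverse system of a square system with invertible feedthrough matrix. -/
def inv [Fintype ι] [DecidableEq ι] (F : StateSpace σ ι ι) : StateSpace σ ι ι where
  A := F.A - F.B * F.D⁻¹ * F.C
  B := F.B * F.D⁻¹
  C := -(F.D⁻¹ * F.C)
  D := F.D⁻¹

/-- The algebraic loop matrix of the interconnection `F_U(M, Δ)`, in which `M` maps `(w, d)` to
`(v, e)` and `w = Δ v`. The unknowns `(v_t, w_t)` satisfy
`[I, -D_vw; -D_Δ, I] (v_t, w_t) = [C_v, 0; 0, C_Δ] (x_t, x^Δ_t) + [D_vd; 0] d_t`. -/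
def loopMatrix [DecidableEq ι] [DecidableEq ο]
    (M : StateSpace σ (ι ⊕ κ) (ο ⊕ π)) (Δ : StateSpace τ ο ι) : Matrix (ο ⊕ ι) (ο ⊕ ι) ℝ :=
  fromBlocks 1 (-M.D.toBlocks₁₁) (-Δ.D) 1

/-- `F_U(M, Δ)` is well-posed: the loop matrix is nonsingular, so that the loop equations determine
all signals. -/
def UpperWellPosed [Fintype ι] [DecidableEq ι] [Fintype ο] [DecidableEq ο]
    (M : StateSpace σ (ι ⊕ κ) (ο ⊕ π)) (Δ : StateSpace τ ο ι) : Prop :=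
  IsUnit (loopMatrix M Δ)

/-- The interconnection `F_U(M, Δ)` from `d` to `e`, with state `(x, x^Δ)`, obtained by solving the
loop equations for `(v_t, w_t)`. -/
def upperLFT [Fintype ι] [DecidableEq ι] [Fintype ο] [DecidableEq ο]
    (M : StateSpace σ (ι ⊕ κ) (ο ⊕ π)) (Δ : StateSpace τ ο ι) : StateSpace (σ ⊕ τ) κ π where
  A := fromBlocks M.A 0 0 Δ.A +
    fromBlocks 0 M.B.toCols₁ Δ.B 0 * (loopMatrix M Δ)⁻¹ * fromBlocks M.C.toRows₁ 0 0 Δ.C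
  B := fromRows M.B.toCols₂ 0 +
    fromBlocks 0 M.B.toCols₁ Δ.B 0 * (loopMatrix M Δ)⁻¹ * fromRows M.D.toBlocks₁₂ 0
  C := fromCols M.C.toRows₂ 0 +
    fromCols (0 : Matrix π ο ℝ) M.D.toBlocks₂₁ * (loopMatrix M Δ)⁻¹ * fromBlocks M.C.toRows₁ 0 0 Δ.C
  D := M.D.toBlocks₂₂ +
    fromCols (0 : Matrix π ο ℝ) M.D.toBlocks₂₁ * (loopMatrix M Δ)⁻¹ * fromRows M.D.toBlocks₁₂ 0

end StateSpace

/-! ### The uncertain plant and its closed loop -/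

/-- The uncertain plant
`x_{t+1} = A x_t + B_w w_t + B_d d_t + B_u u_t`,
`v_t = C_v x_t + D_vw w_t + D_vd d_t + D_vu u_t`,
`e_t = C_e x_t + D_eu u_t`,
`y_t = C_y x_t + D_yw w_t + D_yd d_t`. -/
structure Plant (nx nw nd nu nv ne ny : ℕ) where
  A : Matrix (Fin nx) (Fin nx) ℝ
  Bw : Matrix (Fin nx) (Fin nw) ℝ
  Bd : Matrix (Fin nx) (Fin nd) ℝ
  Bu : Matrix (Fin nx) (Fin nu) ℝ
  Cv : Matrix (Fin nv) (Fin nx) ℝ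
  Dvw : Matrix (Fin nv) (Fin nw) ℝ
  Dvd : Matrix (Fin nv) (Fin nd) ℝ
  Dvu : Matrix (Fin nv) (Fin nu) ℝ
  Ce : Matrix (Fin ne) (Fin nx) ℝ
  Deu : Matrix (Fin ne) (Fin nu) ℝ
  Cy : Matrix (Fin ny) (Fin nx) ℝ
  Dyw : Matrix (Fin ny) (Fin nw) ℝ
  Dyd : Matrix (Fin ny) (Fin nd) ℝ

variable {nx nw nd nu nv ne ny nK : ℕ}

/-- A causal finite-dimensional LTI output-feedback controller, mapping `y` to `u`. -/
abbrev Controller (nK ny nu : ℕ) := StateSpace (Fin nK) (Fin ny) (Fin nu)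

/-- `F_L(P, K)`, mapping `(w, d)` to `(v, e)`, with state `(x, x^K)`. As `D_yu = 0`, the loop is
closed by substituting `u_t = C_K x^K_t + D_K y_t` and `y_t = C_y x_t + D_yw w_t + D_yd d_t`. -/
def lowerLFT (P : Plant nx nw nd nu nv ne ny) (K : Controller nK ny nu) :
    StateSpace (Fin nx ⊕ Fin nK) (Fin nw ⊕ Fin nd) (Fin nv ⊕ Fin ne) where
  A := fromBlocks (P.A + P.Bu * K.D * P.Cy) (P.Bu * K.C) (K.B * P.Cy) K.A
  B := fromBlocks (P.Bw + P.Bu * K.D * P.Dyw) (P.Bd + P.Bu * K.D * P.Dyd)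
    (K.B * P.Dyw) (K.B * P.Dyd)
  C := fromBlocks (P.Cv + P.Dvu * K.D * P.Cy) (P.Dvu * K.C)
    (P.Ce + P.Deu * K.D * P.Cy) (P.Deu * K.C)
  D := fromBlocks (P.Dvw + P.Dvu * K.D * P.Dyw) (P.Dvd + P.Dvu * K.D * P.Dyd)
    (P.Deu * K.D * P.Dyw) (P.Deu * K.D * P.Dyd)

/-- The set of uncertainties: causal stable LTI systems with `H∞` norm at most one (the state
dimension `k` is arbitrary). -/
def IsUncertainty {k : ℕ} (Δ : StateSpace (Fin k) (Fin nv) (Fin nw)) : Prop :=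
  Δ.IsStable ∧ Δ.hInfNorm ≤ 1

/-- `CL(P, K, Δ)` is well-posed. (The loop around `K` has no algebraic obstruction, as
`D_yu = 0`.) -/
def WellPosed {k : ℕ} (P : Plant nx nw nd nu nv ne ny) (K : Controller nK ny nu)
    (Δ : StateSpace (Fin k) (Fin nv) (Fin nw)) : Prop :=
  (lowerLFT P K).UpperWellPosed Δ

/-- The closed loop `CL(P, K, Δ)` from `d` to `e`, with state `(x, x^K, x^Δ)`. -/
def closedLoop {k : ℕ} (P : Plant nx nw nd nu nv ne ny) (K : Controller nK ny nu)
    (Δ : StateSpace (Fin k) (Fin nv) (Fin nw)) :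
    StateSpace ((Fin nx ⊕ Fin nK) ⊕ Fin k) (Fin nd) (Fin ne) :=
  (lowerLFT P K).upperLFT Δ

/-! ### The optimal non-causal controller of the nominal model (`w = 0`) -/

namespace Plant

variable (P : Plant nx nw nd nu nv ne ny)

def Q : Matrix (Fin nx) (Fin nx) ℝ := P.Ceᵀ * P.Ce

def S : Matrix (Fin nx) (Fin nu) ℝ := P.Ceᵀ * P.Deu

def R : Matrix (Fin nu) (Fin nu) ℝ := P.Deuᵀ * P.Deu

/-- The four standing assumptions on `(A, B_u, C_e, D_eu)`: `R ≻ 0`; `(A, B_u)` is stabilizable;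
`A - B_u R⁻¹ Sᵀ` is nonsingular; and `[A - e^{jθ} I, B_u; C_e, D_eu]` has full column rank for every
`θ ∈ [0, 2π]`. -/
structure Regular : Prop where
  posDef : P.R.PosDef
  stabilizable : ∃ L : Matrix (Fin nu) (Fin nx) ℝ, IsSchur (P.A - P.Bu * L)
  nonsingular : IsUnit (P.A - P.Bu * P.R⁻¹ * P.Sᵀ)
  fullRank : ∀ θ ∈ Set.Icc (0 : ℝ) (2 * Real.pi),
    (fromBlocks (P.A.map (algebraMap ℝ ℂ) -
        Complex.exp (θ * Complex.I) • (1 : Matrix (Fin nx) (Fin nx) ℂ))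
      (P.Bu.map (algebraMap ℝ ℂ)) (P.Ce.map (algebraMap ℝ ℂ))
      (P.Deu.map (algebraMap ℝ ℂ))).rank = nx + nu

/-- `R + B_uᵀ X B_u` -/
def H (X : Matrix (Fin nx) (Fin nx) ℝ) : Matrix (Fin nu) (Fin nu) ℝ :=
  P.R + P.Buᵀ * X * P.Bu

/-- `K_x = (R + B_uᵀ X B_u)⁻¹ (Aᵀ X B_u + S)ᵀ` -/
def Kx (X : Matrix (Fin nx) (Fin nx) ℝ) : Matrix (Fin nu) (Fin nx) ℝ :=
  (P.H X)⁻¹ * (P.Aᵀ * X * P.Bu + P.S)ᵀ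

/-- `K_v = (R + B_uᵀ X B_u)⁻¹ B_uᵀ` -/
def Kv (X : Matrix (Fin nx) (Fin nx) ℝ) : Matrix (Fin nu) (Fin nx) ℝ :=
  (P.H X)⁻¹ * P.Buᵀ

/-- `K_d = (R + B_uᵀ X B_u)⁻¹ B_uᵀ X B_d` -/
def Kd (X : Matrix (Fin nx) (Fin nx) ℝ) : Matrix (Fin nu) (Fin nd) ℝ :=
  (P.H X)⁻¹ * P.Buᵀ * X * P.Bd

/-- `X ⪰ 0` is the stabilizing solution of the discrete-time algebraic Riccati equation. -/
structure IsStabilizingSolution (X : Matrix (Fin nx) (Fin nx) ℝ) : Prop where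
  posSemidef : X.PosSemidef
  riccati : X - P.Aᵀ * X * P.A - P.Q +
    (P.Aᵀ * X * P.Bu + P.S) * (P.H X)⁻¹ * (P.Aᵀ * X * P.Bu + P.S)ᵀ = 0
  schur : IsSchur (P.A - P.Bu * P.Kx X)

/-- `e` is the error produced, for the disturbance `d`, by the nominal plant in closed loop with the
optimal non-causal controller
`v_t = (A - B_u K_x)ᵀ (v_{t+1} + X B_d d_t)`, `v_∞ = 0`,
`u_t = -K_x x_t - K_v v_{t+1} - K_d d_t`, started from `x_{-∞} = 0`.
For the stabilizing `X`, every `d` in `ℓ₂` has exactly one such `e`, and it lies in `ℓ₂`. -/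
def IsNoncausalError (X : Matrix (Fin nx) (Fin nx) ℝ)
    (d : ℤ → Fin nd → ℝ) (e : ℤ → Fin ne → ℝ) : Prop :=
  ∃ (x v : ℤ → Fin nx → ℝ) (u : ℤ → Fin nu → ℝ),
    (∀ t, x (t + 1) = P.A *ᵥ x t + P.Bd *ᵥ d t + P.Bu *ᵥ u t) ∧
    (∀ t, e t = P.Ce *ᵥ x t + P.Deu *ᵥ u t) ∧
    (∀ t, v t = (P.A - P.Bu * P.Kx X)ᵀ *ᵥ (v (t + 1) + (X * P.Bd) *ᵥ d t)) ∧
    (∀ t, u t = -(P.Kx X *ᵥ x t) - P.Kv X *ᵥ v (t + 1) - P.Kd X *ᵥ d t) ∧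
    Tendsto x atBot (𝓝 0) ∧ Tendsto v atTop (𝓝 0)

end Plant

/-- The augmented benchmark error `ê_t = (γ_J e^o_t, γ_d d_t)`. -/
def augmentedError (γd γJ : ℝ) (d : ℤ → Fin nd → ℝ) (eo : ℤ → Fin ne → ℝ) :
    ℤ → Fin ne ⊕ Fin nd → ℝ :=
  fun t => Sum.elim (γJ • eo t) (γd • d t)

/-- `F` is a spectral factor of the non-causal benchmark cost: a square, stable, causal LTI system
with stable causal inverse such that `‖ê‖² = ‖F d‖²` for all `d` in `ℓ₂`. -/
structure IsSpectralFactor {nF : ℕ} (P : Plant nx nw nd nu nv ne ny)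
    (X : Matrix (Fin nx) (Fin nx) ℝ) (γd γJ : ℝ)
    (F : StateSpace (Fin nF) (Fin nd) (Fin nd)) : Prop where
  stable : F.IsStable
  invertible : IsUnit F.D
  inv_stable : F.inv.IsStable
  cost_eq : ∀ d, MemL2 d → ∀ x f, F.IsTrajectory d x f → ∀ eo, P.IsNoncausalError X d eo →
    sqNorm (augmentedError γd γJ d eo) = sqNorm f

/-! ### Robust regret and robust performance -/

/-- Robust `(γ_d, γ_J)`-regret relative to the optimal non-causal controller of the nominal model,
the strict inequality `J(K,d,Δ) < γ_d² ‖d‖² + γ_J² J(K^o,d,0)` being uniform over the directions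
of `d`: for each `Δ` it holds with a margin `ε ‖d‖²`. -/
def AchievesRobustRegret (P : Plant nx nw nd nu nv ne ny) (K : Controller nK ny nu)
    (X : Matrix (Fin nx) (Fin nx) ℝ) (γd γJ : ℝ) : Prop :=
  ∀ (k : ℕ) (Δ : StateSpace (Fin k) (Fin nv) (Fin nw)), IsUncertainty Δ →
    WellPosed P K Δ ∧ (closedLoop P K Δ).IsStable ∧
    ∃ ε > 0, ∀ d, MemL2 d → ∀ x e, (closedLoop P K Δ).IsTrajectory d x e →
      ∀ eo, P.IsNoncausalError X d eo →
        sqNorm e ≤ γd ^ 2 * sqNorm d + γJ ^ 2 * sqNorm eo - ε * sqNorm d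

/-- The version of robust regret with a strict inequality for each nonzero `d` separately. -/
def AchievesPointwiseRobustRegret (P : Plant nx nw nd nu nv ne ny) (K : Controller nK ny nu)
    (X : Matrix (Fin nx) (Fin nx) ℝ) (γd γJ : ℝ) : Prop :=
  ∀ (k : ℕ) (Δ : StateSpace (Fin k) (Fin nv) (Fin nw)), IsUncertainty Δ →
    WellPosed P K Δ ∧ (closedLoop P K Δ).IsStable ∧
    ∀ d, MemL2 d → d ≠ 0 → ∀ x e, (closedLoop P K Δ).IsTrajectory d x e →
      ∀ eo, P.IsNoncausalError X d eo →
        sqNorm e < γd ^ 2 * sqNorm d + γJ ^ 2 * sqNorm eo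

/-- The weighted closed loop `CL(P, K, Δ) F⁻¹`. It is well-posed exactly when `CL(P, K, Δ)` is, as
`F⁻¹` stands outside the feedback loops. -/
def weightedLoop {k nF : ℕ} (P : Plant nx nw nd nu nv ne ny) (K : Controller nK ny nu)
    (Δ : StateSpace (Fin k) (Fin nv) (Fin nw)) (F : StateSpace (Fin nF) (Fin nd) (Fin nd)) :
    StateSpace (((Fin nx ⊕ Fin nK) ⊕ Fin k) ⊕ Fin nF) (Fin nd) (Fin ne) :=
  (closedLoop P K Δ).series F.inv

end

end RobustRegret

/-!
The spectral factor `F` turns the benchmark into a weight: for every `d` in `ℓ₂` the right-hand side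
`γ_d² ‖d‖² + γ_J² J(K^o, d, 0)` equals `‖F d‖²` (`IsSpectralFactor.benchmark_eq`). Since `F` and
`F⁻¹` are both stable, `f = F d` runs through all of `ℓ₂` as `d` does, and `G d = (G F⁻¹) f` for the
closed loop `G`. Regret therefore bounds the `ℓ₂` gain of `G F⁻¹` by one. A margin `ε ‖d‖²` is
the same, up to the finite gains of `F` and `F⁻¹`, as a margin in `‖f‖²`, that is, a gain strictly
below one (`IsSpectralFactor.hInfNorm_lt_one`, `IsSpectralFactor.exists_margin`); without the margin
only the bound by one survives (`IsSpectralFactor.hInfNorm_le_one`).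

What remains is that the `H∞` norm of a stable system is its `ℓ₂` gain. By Parseval's identity, the
Fourier series identify `ℓ₂` signals with square-integrable functions on the circle; there a stable
system multiplies by its transfer function (`StateSpace.isTrajectory_coeffSignal`). Integrating the
pointwise operator-norm bound gives one inequality, together with the existence of trajectories
(`StateSpace.exists_isTrajectory`). For the other, an input equal to a fixed vector on the open set
of frequencies where that vector is amplified by more than `c`, and zero elsewhere, would have gain
more than `c` (`StateSpace.hInfNorm_le_of_gain`). Trajectories are unique because, by Gelfand's
formula, high powers of a Schur matrix do not increase norms, so that a homogeneous solution vanishing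
at `-∞` is zero (`IsSchur.eq_zero_of_tendsto_atBot`).

The non-causal benchmark is an anti-causal stable recursion that drives a causal stable one. Time
reversal in the first shows that its error exists and lies in `ℓ₂` (`Plant.exists_isNoncausalError`,
`Plant.IsNoncausalError.memL2`), so that `J(K^o, d, 0)` is a genuine finite sum.
-/

namespace RobustRegret

/-! ### Schur matrices -/

section Schur

variable {σ τ : Type} [Fintype σ] [DecidableEq σ] [Fintype τ] [DecidableEq τ]

theorem IsSchur.isUnit_smul_one_sub {A : Matrix σ σ ℝ} (hA : IsSchur A) {z : ℂ} (hz : ‖z‖ = 1) :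
    IsUnit (z • (1 : Matrix σ σ ℂ) - A.map (algebraMap ℝ ℂ)) := by
  have h : z ∈ resolventSet ℂ (A.map (algebraMap ℝ ℂ)) := by
    refine spectrum.mem_resolventSet_of_spectralRadius_lt (lt_of_lt_of_eq hA ?_)
    have : ‖z‖₊ = 1 := NNReal.eq (by simpa using hz)
    simp [this]
  rwa [spectrum.mem_resolventSet_iff, Algebra.algebraMap_eq_smul_one] at h

theorem isSchur_fromBlocks_zero₂₁ {A : Matrix σ σ ℝ} {B : Matrix σ τ ℝ} {D : Matrix τ τ ℝ} :
    IsSchur (fromBlocks A B 0 D) ↔ IsSchur A ∧ IsSchur D := by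
  have h : spectrum ℂ ((fromBlocks A B 0 D).map (algebraMap ℝ ℂ)) =
      spectrum ℂ (A.map (algebraMap ℝ ℂ)) ∪ spectrum ℂ (D.map (algebraMap ℝ ℂ)) := by
    ext z
    rw [fromBlocks_map, Set.mem_union, mem_spectrum_iff_isRoot_charpoly,
      mem_spectrum_iff_isRoot_charpoly, mem_spectrum_iff_isRoot_charpoly,
      Matrix.map_zero _ (map_zero _), charpoly_fromBlocks_zero₂₁, Polynomial.root_mul]
  simp only [IsSchur, spectralRadius, h, iSup_union, sup_lt_iff]

theorem IsSchur.transpose {A : Matrix σ σ ℝ} (hA : IsSchur A) : IsSchur Aᵀ := by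
  have h : spectrum ℂ (Aᵀ.map (algebraMap ℝ ℂ)) = spectrum ℂ (A.map (algebraMap ℝ ℂ)) := by
    ext z
    rw [transpose_map, mem_spectrum_iff_isRoot_charpoly, mem_spectrum_iff_isRoot_charpoly,
      charpoly_transpose]
  rw [IsSchur, spectralRadius, h]
  exact hA

open scoped Matrix.Norms.Operator in
/-- By Gelfand's formula the powers of a Schur matrix eventually do not increase norms. -/
theorem IsSchur.eventually_norm_pow_mulVec_le {A : Matrix σ σ ℝ} (hA : IsSchur A) :
    ∀ᶠ n : ℕ in atTop, ∀ v : σ → ℝ, ‖A ^ n *ᵥ v‖ ≤ ‖v‖ := by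
  have h := spectrum.pow_nnnorm_pow_one_div_tendsto_nhds_spectralRadius (A.map (algebraMap ℝ ℂ))
  filter_upwards [h.eventually (gt_mem_nhds hA), eventually_gt_atTop 0] with n hn hn0 v
  have h1 : ‖A.map (algebraMap ℝ ℂ) ^ n‖₊ < 1 := by
    by_contra hlt
    refine hn.not_ge ?_
    have : (1 : ENNReal) ≤ ‖A.map (algebraMap ℝ ℂ) ^ n‖₊ := by exact_mod_cast not_lt.mp hlt
    exact ENNReal.one_le_rpow this (by positivity)
  have h2 : ‖A ^ n‖ = ‖A.map (algebraMap ℝ ℂ) ^ n‖ := by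
    have : A.map (algebraMap ℝ ℂ) ^ n = (A ^ n).map (algebraMap ℝ ℂ) :=
      (map_pow (algebraMap ℝ ℂ).mapMatrix A n).symm
    rw [this]
    simp [linfty_opNorm_def]
  calc ‖A ^ n *ᵥ v‖ ≤ ‖A ^ n‖ * ‖v‖ := linfty_opNorm_mulVec _ _
    _ ≤ 1 * ‖v‖ := by
      gcongr
      rw [h2]
      exact_mod_cast h1.le
    _ = ‖v‖ := one_mul _

/-- A Schur recursion has no nonzero solution that vanishes in the infinite past. -/
theorem IsSchur.eq_zero_of_tendsto_atBot {A : Matrix σ σ ℝ} (hA : IsSchur A) {x : ℤ → σ → ℝ}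
    (hx : ∀ t, x (t + 1) = A *ᵥ x t) (hlim : Tendsto x atBot (𝓝 0)) : x = 0 := by
  funext t
  have hpow : ∀ n : ℕ, x t = A ^ n *ᵥ x (t - n) := by
    intro n
    induction n with
    | zero => simp
    | succ n ih =>
      have h := hx (t - (n + 1 : ℕ))
      rw [show t - ((n + 1 : ℕ) : ℤ) + 1 = t - n by push_cast; ring] at h
      rw [ih, h, mulVec_mulVec, pow_succ]
  have hlim' : Tendsto (fun n : ℕ => ‖x (t - n)‖) atTop (𝓝 0) := by
    have h : Tendsto (fun n : ℕ => t - (n : ℤ)) atTop atBot :=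
      tendsto_atBot.2 fun b => by
        filter_upwards [eventually_ge_atTop (t - b).toNat] with n hn
        omega
    simpa using (hlim.comp h).norm
  have h0 : ‖x t‖ ≤ 0 := by
    refine ge_of_tendsto hlim' ?_
    filter_upwards [hA.eventually_norm_pow_mulVec_le] with n hn
    calc ‖x t‖ = ‖A ^ n *ᵥ x (t - n)‖ := by rw [← hpow n]
      _ ≤ _ := hn _
  simpa using h0

end Schur

/-! ### Square-summable signals -/

section Signals

variable {ι κ ο : Type} [Fintype ι] [Fintype κ] [Fintype ο]

theorem dotProduct_self_nonneg_real (v : ι → ℝ) : 0 ≤ v ⬝ᵥ v :=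
  Finset.sum_nonneg fun i _ => mul_self_nonneg (v i)

theorem sqNorm_nonneg (s : ℤ → ι → ℝ) : 0 ≤ sqNorm s :=
  tsum_nonneg fun t => dotProduct_self_nonneg_real (s t)

theorem memL2_iff_forall {s : ℤ → ι → ℝ} :
    MemL2 s ↔ ∀ i, Summable fun t => s t i ^ 2 := by
  constructor
  · intro h i
    refine Summable.of_nonneg_of_le (fun t => sq_nonneg _) (fun t => ?_) h
    rw [sq]
    exact Finset.single_le_sum (f := fun i => s t i * s t i) (fun j _ => mul_self_nonneg _)
      (Finset.mem_univ i)
  · intro h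
    simp only [sq] at h
    exact summable_sum fun i _ => h i

theorem MemL2.tendsto_cofinite {s : ℤ → ι → ℝ} (hs : MemL2 s) : Tendsto s cofinite (𝓝 0) := by
  rw [tendsto_pi_nhds]
  intro i
  have h := (memL2_iff_forall.1 hs i).tendsto_cofinite_zero
  have h' := h.sqrt
  simp only [Real.sqrt_sq_eq_abs, Real.sqrt_zero] at h'
  exact (tendsto_zero_iff_abs_tendsto_zero _).2 h'

theorem MemL2.tendsto_atBot {s : ℤ → ι → ℝ} (hs : MemL2 s) : Tendsto s atBot (𝓝 0) :=
  hs.tendsto_cofinite.mono_left (by rw [Int.cofinite_eq]; exact le_sup_left)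

theorem MemL2.tendsto_atTop {s : ℤ → ι → ℝ} (hs : MemL2 s) : Tendsto s atTop (𝓝 0) :=
  hs.tendsto_cofinite.mono_left (by rw [Int.cofinite_eq]; exact le_sup_right)

theorem MemL2.add {s r : ℤ → ι → ℝ} (hs : MemL2 s) (hr : MemL2 r) :
    MemL2 fun t => s t + r t := by
  rw [memL2_iff_forall] at *
  intro i
  refine Summable.of_nonneg_of_le (fun t => sq_nonneg _) (fun t => ?_)
    (((hs i).mul_left 2).add ((hr i).mul_left 2))
  simp only [Pi.add_apply]
  nlinarith [sq_nonneg (s t i - r t i)]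

theorem MemL2.mulVec {s : ℤ → ι → ℝ} (hs : MemL2 s) (M : Matrix ο ι ℝ) :
    MemL2 fun t => M *ᵥ s t := by
  rw [memL2_iff_forall]
  intro o
  refine Summable.of_nonneg_of_le (fun t => sq_nonneg _) (fun t => ?_)
    (hs.mul_left (M o ⬝ᵥ M o))
  have := Finset.sum_mul_sq_le_sq_mul_sq Finset.univ (M o) (s t)
  simpa [Matrix.mulVec, dotProduct, sq] using this

theorem MemL2.neg {s : ℤ → ι → ℝ} (hs : MemL2 s) : MemL2 fun t => -s t := by
  simpa [MemL2] using hs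

theorem MemL2.sub {s r : ℤ → ι → ℝ} (hs : MemL2 s) (hr : MemL2 r) :
    MemL2 fun t => s t - r t := by
  simpa only [sub_eq_add_neg] using hs.add hr.neg

theorem MemL2.comp_equiv {s : ℤ → ι → ℝ} (hs : MemL2 s) (e : ℤ ≃ ℤ) : MemL2 fun t => s (e t) :=
  (e.summable_iff (f := fun t => s t ⬝ᵥ s t)).2 hs

theorem sqNorm_pos {s : ℤ → ι → ℝ} (hs : MemL2 s) (h : s ≠ 0) : 0 < sqNorm s := by
  obtain ⟨t, ht⟩ := Function.ne_iff.1 h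
  refine hs.tsum_pos (fun t => dotProduct_self_nonneg_real (s t)) t ?_
  exact lt_of_le_of_ne (dotProduct_self_nonneg_real _)
    (Ne.symm (mt (dotProduct_self_eq_zero).1 ht))

@[simp]
theorem sqNorm_zero : sqNorm (0 : ℤ → ι → ℝ) = 0 := by
  simp [sqNorm]

theorem sqNorm_sumElim_smul {s : ℤ → ι → ℝ} {r : ℤ → κ → ℝ} (hs : MemL2 s) (hr : MemL2 r)
    (a b : ℝ) :
    sqNorm (fun t => Sum.elim (a • s t) (b • r t)) = a ^ 2 * sqNorm s + b ^ 2 * sqNorm r := by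
  rw [sqNorm, sqNorm, sqNorm, ← tsum_mul_left, ← tsum_mul_left,
    ← (hs.mul_left (a ^ 2)).tsum_add (hr.mul_left (b ^ 2))]
  refine tsum_congr fun t => ?_
  simp only [sumElim_dotProduct_sumElim, smul_dotProduct, dotProduct_smul, smul_eq_mul]
  ring

end Signals

/-! ### Fourier series of signals -/

section Fourier

open MeasureTheory AddCircle

variable {ι ο : Type}

/-- A vector-valued function on the circle is square integrable if all its entries are. -/
def SqIntegrable (D : UnitAddCircle → ι → ℂ) : Prop :=
  ∀ i, MemLp (fun s => D s i) 2 haarAddCircle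

/-- The real signal obtained by applying the real-linear functional `L` (the real or the imaginary
part) to the Fourier coefficients of `D`. -/
noncomputable def coeffSignal (L : ℂ →ₗ[ℝ] ℝ) (D : UnitAddCircle → ι → ℂ) : ℤ → ι → ℝ :=
  fun t i => L (fourierCoeff (fun s => D s i) t)

theorem hasSum_sq_norm_fourierCoeff {f : UnitAddCircle → ℂ} (hf : MemLp f 2 haarAddCircle) :
    HasSum (fun n => ‖fourierCoeff f n‖ ^ 2) (∫ s, ‖f s‖ ^ 2 ∂haarAddCircle) := by
  have h := hasSum_sq_fourierCoeff hf.toLp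
  rw [fourierCoeff_congr_ae hf.coeFn_toLp] at h
  convert h using 1
  refine integral_congr_ae ?_
  filter_upwards [hf.coeFn_toLp] with s hs
  rw [hs]

theorem SqIntegrable.integrable_sq_norm [Fintype ι] {D : UnitAddCircle → ι → ℂ}
    (hD : SqIntegrable D) :
    Integrable (fun s => ‖WithLp.toLp 2 (D s)‖ ^ 2) haarAddCircle := by
  simp only [EuclideanSpace.norm_sq_eq]
  exact integrable_finsetSum _ fun i _ => (hD i).integrable_norm_pow two_ne_zero

/-- Parseval's identity, with the coefficients split into real and imaginary parts. -/
theorem SqIntegrable.hasSum_coeffSignal [Fintype ι] {D : UnitAddCircle → ι → ℂ}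
    (hD : SqIntegrable D) :
    HasSum (fun t => coeffSignal Complex.reLm D t ⬝ᵥ coeffSignal Complex.reLm D t +
        coeffSignal Complex.imLm D t ⬝ᵥ coeffSignal Complex.imLm D t)
      (∫ s, ‖WithLp.toLp 2 (D s)‖ ^ 2 ∂haarAddCircle) := by
  have h := hasSum_sum (s := Finset.univ) fun i (_ : i ∈ Finset.univ) =>
    hasSum_sq_norm_fourierCoeff (hD i)
  simp only [EuclideanSpace.norm_sq_eq]
  rw [integral_finsetSum _ fun i _ => (hD i).integrable_norm_pow two_ne_zero]
  convert h using 2 with t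
  simp only [dotProduct, ← Finset.sum_add_distrib, coeffSignal]
  refine Finset.sum_congr rfl fun i _ => ?_
  rw [← Complex.normSq_eq_norm_sq, Complex.normSq_apply]
  rfl

theorem SqIntegrable.memL2_re [Fintype ι] {D : UnitAddCircle → ι → ℂ} (hD : SqIntegrable D) :
    MemL2 (coeffSignal Complex.reLm D) :=
  Summable.of_nonneg_of_le (fun _ => dotProduct_self_nonneg_real _)
    (fun _ => le_add_of_nonneg_right (dotProduct_self_nonneg_real _)) hD.hasSum_coeffSignal.summable

theorem SqIntegrable.memL2_im [Fintype ι] {D : UnitAddCircle → ι → ℂ} (hD : SqIntegrable D) :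
    MemL2 (coeffSignal Complex.imLm D) :=
  Summable.of_nonneg_of_le (fun _ => dotProduct_self_nonneg_real _)
    (fun _ => le_add_of_nonneg_left (dotProduct_self_nonneg_real _)) hD.hasSum_coeffSignal.summable

theorem SqIntegrable.sqNorm_re_add_sqNorm_im [Fintype ι] {D : UnitAddCircle → ι → ℂ}
    (hD : SqIntegrable D) :
    sqNorm (coeffSignal Complex.reLm D) + sqNorm (coeffSignal Complex.imLm D) =
      ∫ s, ‖WithLp.toLp 2 (D s)‖ ^ 2 ∂haarAddCircle := by
  rw [← hD.hasSum_coeffSignal.tsum_eq, sqNorm, sqNorm, ← Summable.tsum_add hD.memL2_re hD.memL2_im]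

theorem SqIntegrable.integrable {D : UnitAddCircle → ι → ℂ} (hD : SqIntegrable D) (i : ι) :
    Integrable (fun s => D s i) haarAddCircle :=
  (hD i).integrable one_le_two

theorem SqIntegrable.mulVec [Fintype ι] {D : UnitAddCircle → ι → ℂ} (hD : SqIntegrable D)
    {M : UnitAddCircle → Matrix ο ι ℂ} (hM : Continuous M) : SqIntegrable fun s => M s *ᵥ D s := by
  intro o
  refine memLp_finsetSum _ fun i _ => ?_
  have hc : Continuous fun s => M s o i := hM.matrix_elem o i
  have h : MemLp (fun s => M s o i) ⊤ (haarAddCircle (T := 1)) :=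
    hc.memLp_top_of_hasCompactSupport (HasCompactSupport.of_compactSpace _) _
  exact MemLp.mul (hD i) h

theorem coeffSignal_mulVec [Fintype ι] (L : ℂ →ₗ[ℝ] ℝ) (A : Matrix ο ι ℝ)
    {D : UnitAddCircle → ι → ℂ} (hD : SqIntegrable D) (t : ℤ) :
    coeffSignal L (fun s => A.map (algebraMap ℝ ℂ) *ᵥ D s) t = A *ᵥ coeffSignal L D t := by
  funext o
  have h : (fun s => (A.map (algebraMap ℝ ℂ) *ᵥ D s) o) =
      ∑ i, fun s => (A o i : ℂ) * D s i := by
    funext s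
    simp [Matrix.mulVec, dotProduct]
  rw [coeffSignal, h, fourierCoeff.sum _ _ fun i _ => (hD.integrable i).const_mul _]
  simp only [Finset.sum_apply, fourierCoeff.const_mul, map_sum, Matrix.mulVec, dotProduct]
  refine Finset.sum_congr rfl fun i _ => ?_
  rw [← Complex.real_smul, map_smul, smul_eq_mul, coeffSignal]

theorem coeffSignal_add (L : ℂ →ₗ[ℝ] ℝ) {D E : UnitAddCircle → ι → ℂ}
    (hD : SqIntegrable D) (hE : SqIntegrable E) (t : ℤ) :
    coeffSignal L (fun s => D s + E s) t = coeffSignal L D t + coeffSignal L E t := by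
  funext i
  have h := fourierCoeff.add (hD.integrable i) (hE.integrable i)
  have h' := congrFun h t
  simp only [coeffSignal, Pi.add_apply, ← map_add]
  exact congrArg L h'

/-- Multiplication by the conjugate of the first character advances a signal by one step. -/
theorem coeffSignal_fourier_neg_one_smul (L : ℂ →ₗ[ℝ] ℝ) (D : UnitAddCircle → ι → ℂ) (t : ℤ) :
    coeffSignal L (fun s => (fourier (-1) s : ℂ) • D s) t = coeffSignal L D (t + 1) := by
  funext i
  simp only [coeffSignal, fourierCoeff, Pi.smul_apply, smul_eq_mul, ← mul_assoc, ← fourier_add]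
  rw [show -(t + 1) = -t + -1 by ring]

/-- Every square-summable real signal is the sequence of Fourier coefficients of a square-integrable
function. -/
theorem MemL2.exists_fourierCoeff_eq [Fintype ι] {d : ℤ → ι → ℝ} (hd : MemL2 d) :
    ∃ D : UnitAddCircle → ι → ℂ, SqIntegrable D ∧
      coeffSignal Complex.reLm D = d ∧ coeffSignal Complex.imLm D = 0 := by
  have hmem : ∀ i, Memℓp (fun t => (d t i : ℂ)) 2 := fun i => by
    refine memℓp_gen ?_
    simpa using memL2_iff_forall.1 hd i
  let f : ι → Lp ℂ 2 (haarAddCircle (T := 1)) := fun i => fourierBasis.repr.symm ⟨_, hmem i⟩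
  have hf : ∀ i t, fourierCoeff (f i) t = (d t i : ℂ) := fun i t => by
    rw [← fourierBasis_repr, LinearIsometryEquiv.apply_symm_apply]
  refine ⟨fun s i => f i s, fun i => Lp.memLp _, ?_, ?_⟩ <;> funext t i
  · simpa [coeffSignal] using congrArg Complex.re (hf i t)
  · simpa [coeffSignal] using congrArg Complex.im (hf i t)

end Fourier

/-! ### Trajectories of stable systems -/

namespace StateSpace

open MeasureTheory AddCircle

variable {σ τ ι κ ο π : Type} [Fintype σ] [DecidableEq σ]

theorem IsTrajectory.unique [Fintype ι] {G : StateSpace σ ι ο} (hG : G.IsStable)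
    {d : ℤ → ι → ℝ} {x x' : ℤ → σ → ℝ} {e e' : ℤ → ο → ℝ}
    (h : G.IsTrajectory d x e) (h' : G.IsTrajectory d x' e') : x = x' ∧ e = e' := by
  obtain ⟨hx, he, hlim⟩ := h
  obtain ⟨hx', he', hlim'⟩ := h'
  have h0 : x - x' = 0 := by
    refine IsSchur.eq_zero_of_tendsto_atBot hG (fun t => ?_)
      (sub_zero (0 : σ → ℝ) ▸ hlim.sub hlim')
    simp only [Pi.sub_apply, hx, hx', mulVec_sub]
    abel
  have hxx : x = x' := sub_eq_zero.1 h0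
  refine ⟨hxx, funext fun t => ?_⟩
  rw [he, he', hxx]

theorem norm_fourier_neg_one (s : UnitAddCircle) : ‖(fourier (-1) s : ℂ)‖ = 1 :=
  Circle.norm_coe _

theorem continuousOn_resolvent {A : Matrix σ σ ℝ} (hA : IsSchur A) :
    ContinuousOn (fun z : ℂ => (z • (1 : Matrix σ σ ℂ) - A.map (algebraMap ℝ ℂ))⁻¹)
      (Metric.sphere 0 1) := by
  intro z hz
  have hu := hA.isUnit_smul_one_sub (mem_sphere_zero_iff_norm.1 hz)
  rw [isUnit_iff_isUnit_det, isUnit_iff_ne_zero] at hu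
  have hc : Continuous fun z : ℂ => z • (1 : Matrix σ σ ℂ) - A.map (algebraMap ℝ ℂ) := by
    fun_prop
  have hinv : ContinuousAt Ring.inverse
      (z • (1 : Matrix σ σ ℂ) - A.map (algebraMap ℝ ℂ)).det := by
    rw [Ring.inverse_eq_inv']
    exact continuousAt_inv₀ hu
  exact (ContinuousAt.comp (f := fun z : ℂ => z • (1 : Matrix σ σ ℂ) - A.map (algebraMap ℝ ℂ))
    (continuousAt_matrix_inv _ hinv) hc.continuousAt).continuousWithinAt

theorem continuous_resolvent_circle {A : Matrix σ σ ℝ} (hA : IsSchur A) :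
    Continuous fun s : UnitAddCircle =>
      ((fourier (-1) s : ℂ) • (1 : Matrix σ σ ℂ) - A.map (algebraMap ℝ ℂ))⁻¹ :=
  (continuousOn_resolvent hA).comp_continuous (fourier (-1)).continuous
    fun s => mem_sphere_zero_iff_norm.2 (norm_fourier_neg_one s)

theorem continuousOn_transfer {G : StateSpace σ ι ο} (hG : G.IsStable) :
    ContinuousOn G.transfer (Metric.sphere 0 1) := by
  have h := continuousOn_resolvent hG
  rw [continuousOn_iff_continuous_domRestrict] at h ⊢
  exact ((continuous_const.matrix_mul h).matrix_mul continuous_const).add continuous_const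

theorem continuous_transfer_circle {G : StateSpace σ ι ο} (hG : G.IsStable) :
    Continuous fun s : UnitAddCircle => G.transfer (fourier (-1) s) :=
  (continuousOn_transfer hG).comp_continuous (fourier (-1)).continuous
    fun s => mem_sphere_zero_iff_norm.2 (norm_fourier_neg_one s)

/-- In the frequency domain a stable system acts by pointwise multiplication with its transfer
function at `z = fourier (-1) s`, the point of the unit circle that represents the forward shift:
the real and imaginary parts of the Fourier coefficients of `D` and of `G(z) D` form an input and an
output of `G`. -/
theorem isTrajectory_coeffSignal [Fintype ι] [Fintype ο] {G : StateSpace σ ι ο} (hG : G.IsStable)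
    {D : UnitAddCircle → ι → ℂ} (hD : SqIntegrable D) :
    ∃ X : UnitAddCircle → σ → ℂ, SqIntegrable X ∧
      SqIntegrable (fun s => G.transfer (fourier (-1) s) *ᵥ D s) ∧
      ∀ L : ℂ →ₗ[ℝ] ℝ, L = Complex.reLm ∨ L = Complex.imLm →
        G.IsTrajectory (coeffSignal L D) (coeffSignal L X)
          (coeffSignal L fun s => G.transfer (fourier (-1) s) *ᵥ D s) := by
  let a := G.A.map (algebraMap ℝ ℂ)
  let b := G.B.map (algebraMap ℝ ℂ)
  let X : UnitAddCircle → σ → ℂ := fun s =>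
    (((fourier (-1) s : ℂ) • (1 : Matrix σ σ ℂ) - a)⁻¹ * b) *ᵥ D s
  have hX : SqIntegrable X :=
    hD.mulVec ((continuous_resolvent_circle hG).matrix_mul continuous_const)
  have hE := hD.mulVec (continuous_transfer_circle hG)
  have hb : SqIntegrable fun s => b *ᵥ D s := hD.mulVec continuous_const
  have ha : SqIntegrable fun s => a *ᵥ X s := hX.mulVec continuous_const
  have hc : SqIntegrable fun s => G.C.map (algebraMap ℝ ℂ) *ᵥ X s := hX.mulVec continuous_const
  have hd : SqIntegrable fun s => G.D.map (algebraMap ℝ ℂ) *ᵥ D s := hD.mulVec continuous_const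
  have hstate : ∀ s, (fourier (-1) s : ℂ) • X s = a *ᵥ X s + b *ᵥ D s := fun s => by
    have hu := hG.isUnit_smul_one_sub (norm_fourier_neg_one s)
    rw [isUnit_iff_isUnit_det] at hu
    have h : ((fourier (-1) s : ℂ) • (1 : Matrix σ σ ℂ) - a) *ᵥ X s = b *ᵥ D s := by
      simp only [X]
      rw [mulVec_mulVec, mul_nonsing_inv_cancel_left _ _ hu]
    rw [sub_mulVec, smul_mulVec, one_mulVec] at h
    rw [← h]
    abel
  have hout : ∀ s, G.transfer (fourier (-1) s) *ᵥ D s =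
      G.C.map (algebraMap ℝ ℂ) *ᵥ X s + G.D.map (algebraMap ℝ ℂ) *ᵥ D s := fun s => by
    simp only [X]
    rw [transfer, add_mulVec, mulVec_mulVec, Matrix.mul_assoc]
  refine ⟨X, hX, hE, fun L hL => ⟨fun t => ?_, fun t => ?_, ?_⟩⟩
  · rw [← coeffSignal_fourier_neg_one_smul, funext hstate, coeffSignal_add L ha hb,
      coeffSignal_mulVec L _ hX, coeffSignal_mulVec L _ hD]
  · rw [funext hout, coeffSignal_add L hc hd, coeffSignal_mulVec L _ hX,
      coeffSignal_mulVec L _ hD]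
  · obtain rfl | rfl := hL
    exacts [hX.memL2_re.tendsto_atBot, hX.memL2_im.tendsto_atBot]

open scoped Matrix.Norms.L2Operator

section HInf

variable [Fintype ι] [DecidableEq ι] [Fintype ο] [DecidableEq ο]

theorem norm_transfer_le_hInfNorm {G : StateSpace σ ι ο} (hG : G.IsStable) {z : ℂ}
    (hz : ‖z‖ = 1) : ‖G.transfer z‖ ≤ G.hInfNorm := by
  -- Without boundedness the supremum would be a junk value.
  have hbdd : BddAbove (Set.range fun θ : Set.Icc (0 : ℝ) (2 * Real.pi) =>
      ‖G.transfer (Complex.exp ((θ : ℝ) * Complex.I))‖) := by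
    refine ((isCompact_sphere (0 : ℂ) 1).image_of_continuousOn
      (continuousOn_transfer hG).norm).bddAbove.mono ?_
    rintro _ ⟨θ, rfl⟩
    exact ⟨_, by simp [Complex.norm_exp_ofReal_mul_I], rfl⟩
  obtain ⟨θ, hθ⟩ : ∃ θ : Set.Icc (0 : ℝ) (2 * Real.pi),
      Complex.exp ((θ : ℝ) * Complex.I) = z := by
    have h : Complex.exp (z.arg * Complex.I) = z := by
      simpa [hz] using Complex.norm_mul_exp_arg_mul_I z
    have h1 := Complex.neg_pi_lt_arg z
    have h2 := Complex.arg_le_pi z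
    rcases le_or_gt 0 z.arg with h0 | h0
    · exact ⟨⟨z.arg, h0, by linarith [Real.pi_pos]⟩, h⟩
    · refine ⟨⟨z.arg + 2 * Real.pi, by linarith, by linarith⟩, ?_⟩
      push_cast
      rw [add_mul, Complex.exp_add, h, Complex.exp_two_pi_mul_I, mul_one]
  rw [← hθ]
  exact le_ciSup hbdd θ

theorem hInfNorm_le {G : StateSpace σ ι ο} {c : ℝ} (h : ∀ s : UnitAddCircle,
    ‖G.transfer (fourier (-1) s)‖ ≤ c) : G.hInfNorm ≤ c := by
  have : Nonempty (Set.Icc (0 : ℝ) (2 * Real.pi)) := ⟨0, le_rfl, by positivity⟩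
  refine ciSup_le fun θ => ?_
  have hz : Complex.exp ((θ : ℝ) * Complex.I) =
      fourier (-1) ((-(θ / (2 * Real.pi)) : ℝ) : UnitAddCircle) := by
    rw [fourier_coe_apply]
    congr 1
    have := Real.pi_ne_zero
    push_cast
    field_simp
  rw [hz]
  exact h _

theorem hInfNorm_nonneg (G : StateSpace σ ι ο) : 0 ≤ G.hInfNorm :=
  Real.iSup_nonneg fun _ => norm_nonneg _

/-- A stable system maps square-summable inputs to square-summable outputs, with gain at most its
`H∞` norm. -/
theorem exists_isTrajectory {G : StateSpace σ ι ο} (hG : G.IsStable) {d : ℤ → ι → ℝ}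
    (hd : MemL2 d) : ∃ x e, G.IsTrajectory d x e ∧ MemL2 x ∧ MemL2 e ∧
      sqNorm e ≤ G.hInfNorm ^ 2 * sqNorm d := by
  obtain ⟨D, hD, hre, him⟩ := hd.exists_fourierCoeff_eq
  obtain ⟨X, hX, hE, htraj⟩ := isTrajectory_coeffSignal hG hD
  refine ⟨_, _, hre ▸ htraj _ (Or.inl rfl), hX.memL2_re, hE.memL2_re, ?_⟩
  have h1 := hE.sqNorm_re_add_sqNorm_im
  have h2 := hD.sqNorm_re_add_sqNorm_im
  rw [hre, him, sqNorm_zero, add_zero] at h2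
  calc _ ≤ _ := le_add_of_nonneg_right (sqNorm_nonneg _)
    _ = _ := h1
    _ ≤ ∫ s, G.hInfNorm ^ 2 * ‖WithLp.toLp 2 (D s)‖ ^ 2 ∂haarAddCircle := by
      refine integral_mono hE.integrable_sq_norm (hD.integrable_sq_norm.const_mul _) fun s => ?_
      simp only [← mul_pow]
      gcongr
      refine (l2_opNorm_mulVec _ (WithLp.toLp 2 (D s))).trans ?_
      gcongr
      exact norm_transfer_le_hInfNorm hG (norm_fourier_neg_one s)
    _ = _ := by rw [integral_const_mul, ← h2]

theorem IsTrajectory.memL2_state {G : StateSpace σ ι ο} (hG : G.IsStable) {d : ℤ → ι → ℝ}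
    {x : ℤ → σ → ℝ} {e : ℤ → ο → ℝ} (h : G.IsTrajectory d x e) (hd : MemL2 d) : MemL2 x := by
  obtain ⟨x', e', h', hx', -⟩ := exists_isTrajectory hG hd
  rwa [(h.unique hG h').1]

theorem IsTrajectory.sqNorm_le {G : StateSpace σ ι ο} (hG : G.IsStable) {d : ℤ → ι → ℝ}
    {x : ℤ → σ → ℝ} {e : ℤ → ο → ℝ} (h : G.IsTrajectory d x e) (hd : MemL2 d) :
    sqNorm e ≤ G.hInfNorm ^ 2 * sqNorm d := by
  obtain ⟨x', e', h', -, -, hle⟩ := exists_isTrajectory hG hd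
  rwa [(h.unique hG h').2]

/-- The `H∞` norm is the smallest `ℓ₂` gain: inputs whose spectrum concentrates where the transfer
function is large in a fixed direction are amplified by more than any smaller gain. -/
theorem hInfNorm_le_of_gain {G : StateSpace σ ι ο} (hG : G.IsStable) {c : ℝ} (hc : 0 ≤ c)
    (h : ∀ d, MemL2 d → ∀ x e, G.IsTrajectory d x e → sqNorm e ≤ c ^ 2 * sqNorm d) :
    G.hInfNorm ≤ c := by
  refine hInfNorm_le fun s₀ => ?_
  rw [l2_opNorm_def]
  refine ContinuousLinearMap.opNorm_le_bound _ hc fun u => ?_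
  by_contra! hlt
  let g : UnitAddCircle → ℝ := fun s =>
    ‖WithLp.toLp 2 (G.transfer (fourier (-1) s) *ᵥ u.ofLp)‖ ^ 2 - c ^ 2 * ‖u‖ ^ 2
  have hgc : Continuous g := by
    have := continuous_transfer_circle hG
    refine Continuous.sub (Continuous.pow (Continuous.norm ?_) 2) continuous_const
    exact (PiLp.continuous_toLp 2 _).comp (this.matrix_mulVec continuous_const)
  -- `U` is the set of frequencies at which the direction `u` is amplified by more than `c`; the
  -- spectrum of the test input is the indicator of `U` times `u`.
  let U : Set UnitAddCircle := {s | 0 < g s}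
  have hU : IsOpen U := isOpen_lt continuous_const hgc
  have hs₀ : s₀ ∈ U := by
    have : (c * ‖u‖) ^ 2 < ‖WithLp.toLp 2 (G.transfer (fourier (-1) s₀) *ᵥ u.ofLp)‖ ^ 2 :=
      pow_lt_pow_left₀ hlt (by positivity) two_ne_zero
    simpa [U, g, mul_pow] using this
  let D : UnitAddCircle → ι → ℂ := fun s i => U.indicator (fun _ => u i) s
  have hD : SqIntegrable D := fun i =>
    memLp_indicator_const 2 hU.measurableSet (u i) (Or.inr (measure_ne_top _ _))
  obtain ⟨X, hX, hE, htraj⟩ := isTrajectory_coeffSignal hG hD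
  have hle : ∫ s, ‖WithLp.toLp 2 (G.transfer (fourier (-1) s) *ᵥ D s)‖ ^ 2 ∂haarAddCircle ≤
      c ^ 2 * ∫ s, ‖WithLp.toLp 2 (D s)‖ ^ 2 ∂haarAddCircle := by
    rw [← hE.sqNorm_re_add_sqNorm_im, ← hD.sqNorm_re_add_sqNorm_im, mul_add]
    exact add_le_add (h _ hD.memL2_re _ _ (htraj _ (Or.inl rfl)))
      (h _ hD.memL2_im _ _ (htraj _ (Or.inr rfl)))
  rw [← integral_const_mul, ← sub_nonpos,
    ← integral_sub hE.integrable_sq_norm (hD.integrable_sq_norm.const_mul _)] at hle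
  have hind : ∀ s, ‖WithLp.toLp 2 (G.transfer (fourier (-1) s) *ᵥ D s)‖ ^ 2 -
      c ^ 2 * ‖WithLp.toLp 2 (D s)‖ ^ 2 = U.indicator g s := fun s => by
    by_cases hs : s ∈ U
    · have : D s = u.ofLp := funext fun i => by simp [D, hs]
      simp [this, hs, g]
    · have : D s = 0 := funext fun i => by simp [D, hs]
      simp [this, hs]
  simp only [hind] at hle
  rw [integral_indicator hU.measurableSet] at hle
  refine hle.not_gt ?_
  rw [setIntegral_pos_iff_support_of_nonneg_ae]
  · have : Function.support g ∩ U = U :=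
      Set.inter_eq_right.2 fun s (hs : 0 < g s) => hs.ne'
    rw [this]
    exact hU.measure_pos _ ⟨s₀, hs₀⟩
  · exact (ae_restrict_iff' hU.measurableSet).2 (Eventually.of_forall fun s hs => le_of_lt hs)
  · exact (hgc.integrable_of_hasCompactSupport (HasCompactSupport.of_compactSpace _)).integrableOn

end HInf

end StateSpace

/-! ### Interconnections -/

namespace StateSpace

variable {σ τ ι ο π : Type} [Fintype σ] [Fintype τ]

theorem isStable_series_iff [Fintype ο] [DecidableEq σ] [DecidableEq τ] {G : StateSpace σ ο π}
    {H : StateSpace τ ι ο} : (G.series H).IsStable ↔ G.IsStable ∧ H.IsStable :=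
  isSchur_fromBlocks_zero₂₁

theorem IsTrajectory.series [Fintype ι] [Fintype ο] {G : StateSpace σ ο π} {H : StateSpace τ ι ο}
    {d : ℤ → ι → ℝ} {xH : ℤ → τ → ℝ} {y : ℤ → ο → ℝ} {xG : ℤ → σ → ℝ} {e : ℤ → π → ℝ}
    (hG : G.IsTrajectory y xG e) (hH : H.IsTrajectory d xH y) :
    (G.series H).IsTrajectory d (fun t => Sum.elim (xG t) (xH t)) e := by
  obtain ⟨hxG, he, hlimG⟩ := hG
  obtain ⟨hxH, hy, hlimH⟩ := hH
  refine ⟨fun t => ?_, fun t => ?_, ?_⟩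
  · simp only [StateSpace.series, fromBlocks_mulVec, fromRows_mulVec, hxG, hxH, hy,
      Sum.elim_comp_inl, Sum.elim_comp_inr, zero_mulVec, zero_add, mulVec_add, mulVec_mulVec]
    rw [← add_assoc]
    ext (i | i) <;> simp
  · simp only [StateSpace.series, fromCols_mulVec_sumElim, he, hy, mulVec_add, mulVec_mulVec,
      add_assoc]
  · rw [tendsto_pi_nhds] at *
    rintro (i | i)
    exacts [hlimG i, hlimH i]

theorem isTrajectory_inv_iff [Fintype ι] [DecidableEq ι] {F : StateSpace σ ι ι}
    (hF : IsUnit F.D) {d f : ℤ → ι → ℝ} {x : ℤ → σ → ℝ} :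
    F.inv.IsTrajectory f x d ↔ F.IsTrajectory d x f := by
  rw [isUnit_iff_isUnit_det] at hF
  have hout : (∀ t, d t = F.inv.C *ᵥ x t + F.inv.D *ᵥ f t) ↔
      ∀ t, f t = F.C *ᵥ x t + F.D *ᵥ d t := by
    refine forall_congr' fun t => ⟨fun h => ?_, fun h => ?_⟩
    · rw [h]
      simp only [StateSpace.inv, neg_mulVec, mulVec_add, mulVec_neg, mulVec_mulVec,
        mul_nonsing_inv_cancel_left _ _ hF, mul_nonsing_inv _ hF, one_mulVec]
      abel
    · rw [h]
      simp only [StateSpace.inv, neg_mulVec, mulVec_add, mulVec_mulVec,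
        nonsing_inv_mul _ hF, one_mulVec]
      abel
  unfold IsTrajectory
  rw [hout]
  refine and_congr_left fun h => forall_congr' fun t => ?_
  have hstate : F.inv.A *ᵥ x t + F.inv.B *ᵥ f t = F.A *ᵥ x t + F.B *ᵥ d t := by
    rw [hout.2 h.1 t]
    simp only [StateSpace.inv, sub_mulVec, neg_mulVec, mulVec_add, mulVec_neg, mulVec_mulVec,
      Matrix.mul_assoc]
    abel
  rw [hstate]

end StateSpace

/-! ### The non-causal benchmark -/

section Recursions

variable {σ : Type} [Fintype σ] [DecidableEq σ] {A : Matrix σ σ ℝ} {r x : ℤ → σ → ℝ}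

/-- The system `x_{t+1} = A x_t + r_t` with the state as output. -/
def drivenState (A : Matrix σ σ ℝ) : StateSpace σ σ σ := ⟨A, 1, 1, 0⟩

theorem isStable_drivenState (hA : IsSchur A) : (drivenState A).IsStable := hA

theorem isTrajectory_drivenState (hx : ∀ t, x (t + 1) = A *ᵥ x t + r t)
    (hlim : Tendsto x atBot (𝓝 0)) : (drivenState A).IsTrajectory r x x :=
  ⟨fun t => by simpa [drivenState] using hx t, fun t => by simp [drivenState], hlim⟩

theorem IsSchur.memL2_of_recursion (hA : IsSchur A) (hr : MemL2 r)
    (hx : ∀ t, x (t + 1) = A *ᵥ x t + r t) (hlim : Tendsto x atBot (𝓝 0)) : MemL2 x :=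
  (isTrajectory_drivenState hx hlim).memL2_state (isStable_drivenState hA) hr

theorem IsSchur.exists_recursion (hA : IsSchur A) (hr : MemL2 r) :
    ∃ x : ℤ → σ → ℝ, MemL2 x ∧ ∀ t, x (t + 1) = A *ᵥ x t + r t := by
  obtain ⟨x, e, ⟨h, -, -⟩, hx, -⟩ :=
    StateSpace.exists_isTrajectory (isStable_drivenState hA) hr
  exact ⟨x, hx, fun t => by simpa [drivenState] using h t⟩

theorem IsSchur.memL2_of_backward_recursion (hA : IsSchur A) (hr : MemL2 r)
    (hx : ∀ t, x t = A *ᵥ x (t + 1) + r t) (hlim : Tendsto x atTop (𝓝 0)) : MemL2 x := by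
  -- The reversed signal `x_{-t}` satisfies a forward recursion driven by `r_{-1-t}`.
  have h : MemL2 fun t => x (-t) := by
    refine hA.memL2_of_recursion (r := fun t => r (-1 - t)) (hr.comp_equiv (Equiv.subLeft (-1)))
      (fun t => ?_) (hlim.comp tendsto_neg_atBot_atTop)
    rw [hx]
    congr 3 <;> ring_nf
  simpa using h.comp_equiv (Equiv.neg ℤ)

theorem IsSchur.exists_backward_recursion (hA : IsSchur A) (hr : MemL2 r) :
    ∃ x : ℤ → σ → ℝ, MemL2 x ∧ ∀ t, x t = A *ᵥ x (t + 1) + r t := by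
  obtain ⟨x, hx, h⟩ :=
    hA.exists_recursion (r := fun t => r (-1 - t)) (hr.comp_equiv (Equiv.subLeft (-1)))
  refine ⟨fun t => x (-t), hx.comp_equiv (Equiv.neg ℤ), fun t => ?_⟩
  have := h (-t - 1)
  rw [sub_add_cancel, show -1 - (-t - 1) = t by ring, ← neg_add'] at this
  exact this

end Recursions

namespace Plant

variable {nx nw nd nu nv ne ny : ℕ} {P : Plant nx nw nd nu nv ne ny}
  {X : Matrix (Fin nx) (Fin nx) ℝ} {d : ℤ → Fin nd → ℝ}

/-- The non-causal feedback turns the plant into a system with the Schur matrix `A - B_u K_x`,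
driven by `d_t` and `v_{t+1}`. -/
theorem closed_state_eq (x v : Fin nx → ℝ) (d : Fin nd → ℝ) :
    P.A *ᵥ x + P.Bd *ᵥ d + P.Bu *ᵥ (-(P.Kx X *ᵥ x) - P.Kv X *ᵥ v - P.Kd X *ᵥ d) =
      (P.A - P.Bu * P.Kx X) *ᵥ x +
        (P.Bd *ᵥ d - P.Bu *ᵥ (P.Kv X *ᵥ v + P.Kd X *ᵥ d)) := by
  simp only [sub_mulVec, mulVec_sub, mulVec_neg, mulVec_add, mulVec_mulVec]
  abel

theorem exists_isNoncausalError (hX : IsSchur (P.A - P.Bu * P.Kx X)) (hd : MemL2 d) :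
    ∃ e, P.IsNoncausalError X d e := by
  obtain ⟨v, hv, hv'⟩ := hX.transpose.exists_backward_recursion
    ((hd.mulVec (X * P.Bd)).mulVec (P.A - P.Bu * P.Kx X)ᵀ)
  have hv1 : MemL2 fun t => v (t + 1) := hv.comp_equiv (Equiv.addRight 1)
  obtain ⟨x, hx, hx'⟩ := hX.exists_recursion
    ((hd.mulVec P.Bd).sub (((hv1.mulVec (P.Kv X)).add (hd.mulVec (P.Kd X))).mulVec P.Bu))
  refine ⟨_, x, v, _, fun t => ?_, fun t => rfl, fun t => ?_, fun t => rfl, hx.tendsto_atBot,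
    hv.tendsto_atTop⟩
  · rw [hx', closed_state_eq]
  · rw [hv', mulVec_add]

theorem IsNoncausalError.memL2 (hX : IsSchur (P.A - P.Bu * P.Kx X)) (hd : MemL2 d)
    {e : ℤ → Fin ne → ℝ} (he : P.IsNoncausalError X d e) : MemL2 e := by
  obtain ⟨x, v, u, hx, he, hv, hu, hxlim, hvlim⟩ := he
  have hvL : MemL2 v := hX.transpose.memL2_of_backward_recursion
    ((hd.mulVec (X * P.Bd)).mulVec (P.A - P.Bu * P.Kx X)ᵀ)
    (fun t => (hv t).trans (mulVec_add _ _ _)) hvlim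
  have hv1 : MemL2 fun t => v (t + 1) := hvL.comp_equiv (Equiv.addRight 1)
  have hxL : MemL2 x := hX.memL2_of_recursion
    ((hd.mulVec P.Bd).sub (((hv1.mulVec (P.Kv X)).add (hd.mulVec (P.Kd X))).mulVec P.Bu))
    (fun t => by rw [hx, hu, closed_state_eq]) hxlim
  have huL : MemL2 u := by
    rw [funext hu]
    exact ((hxL.mulVec _).neg.sub (hv1.mulVec _)).sub (hd.mulVec _)
  rw [funext he]
  exact (hxL.mulVec _).add (huL.mulVec _)

end Plant

/-! ### Regret as a weighted gain -/

section Regret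

variable {nx nw nd nu nv ne ny nF : ℕ} {P : Plant nx nw nd nu nv ne ny}
  {X : Matrix (Fin nx) (Fin nx) ℝ} {γd γJ : ℝ} {F : StateSpace (Fin nF) (Fin nd) (Fin nd)}

theorem IsSpectralFactor.benchmark_eq (hF : IsSpectralFactor P X γd γJ F)
    (hX : IsSchur (P.A - P.Bu * P.Kx X)) {d : ℤ → Fin nd → ℝ} (hd : MemL2 d)
    {x : ℤ → Fin nF → ℝ} {f : ℤ → Fin nd → ℝ} (hf : F.IsTrajectory d x f)
    {eo : ℤ → Fin ne → ℝ} (heo : P.IsNoncausalError X d eo) :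
    γd ^ 2 * sqNorm d + γJ ^ 2 * sqNorm eo = sqNorm f := by
  rw [← hF.cost_eq d hd x f hf eo heo, add_comm]
  exact (sqNorm_sumElim_smul (heo.memL2 hX hd) hd γJ γd).symm

variable {σ ο : Type} [Fintype σ] [DecidableEq σ] [Fintype ο] [DecidableEq ο]

/-- Every square-summable trajectory of `G F⁻¹` arises from a disturbance `d` whose response under
`G` is the output and whose response under `F` is the input. -/
theorem IsSpectralFactor.exists_disturbance (hF : IsSpectralFactor P X γd γJ F)
    {G : StateSpace σ (Fin nd) ο} (hG : G.IsStable) {f : ℤ → Fin nd → ℝ} (hf : MemL2 f)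
    {x : ℤ → σ ⊕ Fin nF → ℝ} {e : ℤ → ο → ℝ} (h : (G.series F.inv).IsTrajectory f x e) :
    ∃ d xF xG, MemL2 d ∧ F.IsTrajectory d xF f ∧ G.IsTrajectory d xG e := by
  obtain ⟨xF, d, hdF, -, hd, -⟩ := StateSpace.exists_isTrajectory hF.inv_stable hf
  obtain ⟨xG, e', hG', -⟩ := StateSpace.exists_isTrajectory hG hd
  obtain rfl := (h.unique (StateSpace.isStable_series_iff.2 ⟨hG, hF.inv_stable⟩)
    (hG'.series hdF)).2
  exact ⟨d, xF, xG, hd, (StateSpace.isTrajectory_inv_iff hF.invertible).1 hdF, hG'⟩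

/-- A uniform regret margin gives a weighted `H∞` norm below one: the margin in `‖d‖²` is one in
`‖F d‖²` because `F` has finite gain. -/
theorem IsSpectralFactor.hInfNorm_lt_one (hF : IsSpectralFactor P X γd γJ F)
    (hX : IsSchur (P.A - P.Bu * P.Kx X)) {G : StateSpace σ (Fin nd) ο} (hG : G.IsStable)
    {ε : ℝ} (hε : 0 < ε)
    (h : ∀ d, MemL2 d → ∀ x e, G.IsTrajectory d x e → ∀ eo, P.IsNoncausalError X d eo →
      sqNorm e ≤ γd ^ 2 * sqNorm d + γJ ^ 2 * sqNorm eo - ε * sqNorm d) :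
    (G.series F.inv).hInfNorm < 1 := by
  have hc : 0 < F.hInfNorm ^ 2 + 1 := by positivity
  have hδ : 0 < ε / (F.hInfNorm ^ 2 + 1) := by positivity
  -- The `+ 1` keeps the denominator nonzero; a negative radicand makes the root zero, which is
  -- still a valid gain.
  refine lt_of_le_of_lt (StateSpace.hInfNorm_le_of_gain
    (StateSpace.isStable_series_iff.2 ⟨hG, hF.inv_stable⟩)
    (Real.sqrt_nonneg (1 - ε / (F.hInfNorm ^ 2 + 1))) fun f hf x e hfe => ?_)
    ((Real.sqrt_lt' one_pos).2 (by linarith))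
  obtain ⟨d, xF, xG, hd, hdF, hdG⟩ := hF.exists_disturbance hG hf hfe
  obtain ⟨eo, heo⟩ := P.exists_isNoncausalError hX hd
  have h1 := h d hd _ _ hdG _ heo
  rw [hF.benchmark_eq hX hd hdF heo] at h1
  have h2 := hdF.sqNorm_le hF.stable hd
  have h3 : ε / (F.hInfNorm ^ 2 + 1) * sqNorm f ≤ ε * sqNorm d := by
    rw [div_mul_eq_mul_div, div_le_iff₀ hc]
    nlinarith [sqNorm_nonneg d]
  calc sqNorm e ≤ (1 - ε / (F.hInfNorm ^ 2 + 1)) * sqNorm f := by linarith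
    _ ≤ √(1 - ε / (F.hInfNorm ^ 2 + 1)) ^ 2 * sqNorm f := by
      refine mul_le_mul_of_nonneg_right ?_ (sqNorm_nonneg f)
      rw [Real.sq_sqrt']
      exact le_max_left _ _

/-- Conversely, a weighted `H∞` norm below one leaves a margin in `‖F d‖²`, hence one in `‖d‖²`
because `F⁻¹` has finite gain. -/
theorem IsSpectralFactor.exists_margin (hF : IsSpectralFactor P X γd γJ F)
    (hX : IsSchur (P.A - P.Bu * P.Kx X)) {G : StateSpace σ (Fin nd) ο} (hG : G.IsStable)
    (h : (G.series F.inv).hInfNorm < 1) :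
    ∃ ε > 0, ∀ d, MemL2 d → ∀ x e, G.IsTrajectory d x e → ∀ eo, P.IsNoncausalError X d eo →
      sqNorm e ≤ γd ^ 2 * sqNorm d + γJ ^ 2 * sqNorm eo - ε * sqNorm d := by
  set η := 1 - (G.series F.inv).hInfNorm ^ 2 with hη
  have hη0 : 0 < η := by
    have := pow_lt_one₀ (G.series F.inv).hInfNorm_nonneg h two_ne_zero
    linarith
  have hc : 0 < F.inv.hInfNorm ^ 2 + 1 := by positivity
  refine ⟨η / (F.inv.hInfNorm ^ 2 + 1), by positivity, fun d hd x e hde eo heo => ?_⟩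
  obtain ⟨xF, f, hdF, -, hf, -⟩ := StateSpace.exists_isTrajectory hF.stable hd
  have hfd := (StateSpace.isTrajectory_inv_iff hF.invertible).2 hdF
  rw [hF.benchmark_eq hX hd hdF heo]
  have h1 := (hde.series hfd).sqNorm_le
    (StateSpace.isStable_series_iff.2 ⟨hG, hF.inv_stable⟩) hf
  have h2 := hfd.sqNorm_le hF.inv_stable hf
  have h3 : η / (F.inv.hInfNorm ^ 2 + 1) * sqNorm d ≤ η * sqNorm f := by
    rw [div_mul_eq_mul_div, div_le_iff₀ hc]
    nlinarith [sqNorm_nonneg f]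
  have h4 : (G.series F.inv).hInfNorm ^ 2 = 1 - η := by rw [hη]; ring
  rw [h4] at h1
  linarith

theorem IsSpectralFactor.hInfNorm_le_one (hF : IsSpectralFactor P X γd γJ F)
    (hX : IsSchur (P.A - P.Bu * P.Kx X)) {G : StateSpace σ (Fin nd) ο} (hG : G.IsStable)
    (h : ∀ d, MemL2 d → d ≠ 0 → ∀ x e, G.IsTrajectory d x e →
      ∀ eo, P.IsNoncausalError X d eo →
        sqNorm e < γd ^ 2 * sqNorm d + γJ ^ 2 * sqNorm eo) :
    (G.series F.inv).hInfNorm ≤ 1 := by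
  refine StateSpace.hInfNorm_le_of_gain
    (StateSpace.isStable_series_iff.2 ⟨hG, hF.inv_stable⟩) zero_le_one fun f hf x e hfe => ?_
  obtain ⟨d, xF, xG, hd, hdF, hdG⟩ := hF.exists_disturbance hG hf hfe
  obtain ⟨eo, heo⟩ := P.exists_isNoncausalError hX hd
  rw [one_pow, one_mul]
  by_cases h0 : d = 0
  · have h1 := hdG.sqNorm_le hG hd
    rw [h0, sqNorm_zero, mul_zero] at h1
    exact h1.trans (sqNorm_nonneg f)
  · have h1 := h d hd h0 _ _ hdG _ heo
    rw [hF.benchmark_eq hX hd hdF heo] at h1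
    exact h1.le

end Regret

end RobustRegret

theorem mainTheorem1 {nx nw nd nu nv ne ny nK nF : ℕ}
    (P : RobustRegret.Plant nx nw nd nu nv ne ny) (hP : P.Regular)
    (X : Matrix (Fin nx) (Fin nx) ℝ) (hX : P.IsStabilizingSolution X)
    (γd γJ : ℝ) (hγd : 0 ≤ γd) (hγJ : 0 ≤ γJ)
    (F : RobustRegret.StateSpace (Fin nF) (Fin nd) (Fin nd))
    (hF : RobustRegret.IsSpectralFactor P X γd γJ F)
    (K : RobustRegret.Controller nK ny nu) :
    (RobustRegret.AchievesRobustRegret P K X γd γJ ↔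
      ∀ (k : ℕ) (Δ : RobustRegret.StateSpace (Fin k) (Fin nv) (Fin nw)),
        RobustRegret.IsUncertainty Δ →
          RobustRegret.WellPosed P K Δ ∧ (RobustRegret.weightedLoop P K Δ F).IsStable ∧
            (RobustRegret.weightedLoop P K Δ F).hInfNorm < 1) ∧
    (RobustRegret.AchievesRobustRegret P K X γd γJ →
      RobustRegret.AchievesPointwiseRobustRegret P K X γd γJ) ∧
    (RobustRegret.AchievesPointwiseRobustRegret P K X γd γJ →
      ∀ (k : ℕ) (Δ : RobustRegret.StateSpace (Fin k) (Fin nv) (Fin nw)),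
        RobustRegret.IsUncertainty Δ →
          RobustRegret.WellPosed P K Δ ∧ (RobustRegret.weightedLoop P K Δ F).IsStable ∧
            (RobustRegret.weightedLoop P K Δ F).hInfNorm ≤ 1) := by
  refine ⟨⟨fun h k Δ hΔ => ?_, fun h k Δ hΔ => ?_⟩, fun h k Δ hΔ => ?_, fun h k Δ hΔ => ?_⟩
  · obtain ⟨hwp, hst, ε, hε, hle⟩ := h k Δ hΔ
    exact ⟨hwp, RobustRegret.StateSpace.isStable_series_iff.2 ⟨hst, hF.inv_stable⟩,
      hF.hInfNorm_lt_one hX.schur hst hε hle⟩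
  · obtain ⟨hwp, hst, hlt⟩ := h k Δ hΔ
    have hst' := (RobustRegret.StateSpace.isStable_series_iff.1 hst).1
    exact ⟨hwp, hst', hF.exists_margin hX.schur hst' hlt⟩
  · obtain ⟨hwp, hst, ε, hε, hle⟩ := h k Δ hΔ
    refine ⟨hwp, hst, fun d hd h0 x e hde eo heo => ?_⟩
    have := mul_pos hε (RobustRegret.sqNorm_pos hd h0)
    linarith [hle d hd x e hde eo heo]
  · obtain ⟨hwp, hst, hlt⟩ := h k Δ hΔ
    exact ⟨hwp, RobustRegret.StateSpace.isStable_series_iff.2 ⟨hst, hF.inv_stable⟩,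
      hF.hInfNorm_le_one hX.schur hst hlt⟩
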